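/- Let $A$ be a finite set of alternatives. A preference is a strict linear order $P$ on $A$; $a\,P\,b$ means that $a$ is ranked strictly above $b$, $r(P,a)=|\{b: b\,P\,a\}|+1$ is the rank of $a$, and $r_1(P)$ is the alternative of rank $1$. Two preferences $P,P'$ are adjacent, $P\sim P'$, if they differ exactly by swapping two consecutively ranked alternatives. A domain is a set $\mathbb D$ of preferences; it is minimally rich if every $a\in A$ equals $r_1(P)$ for some $P\in\mathbb D$. A path in $\mathbb D$ is a finite sequence of distinct preferences in $\mathbb D$ of which consecutive ones are adjacent. For $n\ge 2$ voters, a social choice function (scf) on $\mathbb D$ is a map $f:\mathbb D^n\to A$. It is *unanimous* if $f(P)=a$ whenever $r_1(P_i)=a$ for all $i$; *locally strategy-proof* if there are no voter $i$, profile $P\in\mathbb D^n$ and $P_i'\in\mathbb D$ with $P_i\sim P_i'$ such that $f(P_i',P_{-i})\;P_i\;f(P)$; *tops-only* if $f(P)=f(P')$ whenever $r_1(P_i)=r_1(P'_i)$ for all $i$; *dictatorial* if there is a voter $i$ with $f(P)=r_1(P_i)$ for all $P\in\mathbb D^n$. The domain $\mathbb D$ is *L-tops-only* if every unanimous and locally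 strategy-proof scf on it is tops-only. The top-connected closure of $P\in\mathbb D$ is the set of all $P'\in\mathbb D$ that can be reached from $P$ by a path in $\mathbb D$ along which the first-ranked alternative does not change; a neighbour of a subset of $\mathbb D$ is a preference in $\mathbb D$ outside that subset that is adjacent to some member of it. $\mathbb D$ is *connected with two distinct neighbours* if every two members of $\mathbb D$ are joined by a path in $\mathbb D$ and, for every $P\in\mathbb D$, the top-connected closure of $P$ has two neighbours $P',P''$ with $r_1(P')\ne r_1(P'')$. A path has no $\{a,b\}$-restoration if the relative ranking of $a$ and $b$ is reversed at most once along it. $\mathbb D$ satisfies *Property P* if for all distinct $P,P'\in\mathbb D$ and all distinct $a,b\in A$ there is a path from $P$ to $P'$ in $\mathbb D$ with no $\{a,b\}$-restoration; $\mathbb D$ is a *sparsely connected domain without restoration* (SCD) if this holds for all distinct $a,b$ of which at least one is first-ranked in some member of $\mathbb D$. Let $A=\{a_1,a_2,a_3,a_4\}$, and let $\mathbb D^*$ consist of the following thirteen preferences, each written from best to worst ($1234$ stands for $a_1,a_2,a_3,a_4$): $$1234,\ 2134,\ 2314,\ 3214,\ 3241,\ 3421,\ 4321,\ 4312,\ 4132,\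 4123,\ 1423,\ 1243,\ 1324.$$ Then these thirteen preferences are distinct, and: 1. $\mathbb D^*$ is minimally rich and, for every number $n\ge 2$ of voters, L-tops-only; 2. for every $n\ge 2$, every unanimous and locally strategy-proof scf $f:(\mathbb D^*)^n\to A$ is dictatorial; 3. $\mathbb D^*$ is connected with two distinct neighbours, but it does not satisfy Property P and is not a sparsely connected domain without restoration. -/

import Mathlib

namespace Voting

/-- A linear order over `A`, recorded through its strict part: `P.pref a b` says that `a` is
ranked strictly above `b`. -/
@[ext]
structure Preference (A : Type*) where
  pref : A → A → Prop
  irrefl : ∀ a, ¬ pref a a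
  trans : ∀ a b c, pref a b → pref b c → pref a c
  total : ∀ a b, a ≠ b → pref a b ∨ pref b a

namespace Preference

variable {A : Type*}

/-- The rank of `a` in `P`: one plus the number of alternatives strictly above `a`. -/
noncomputable def rank (P : Preference A) (a : A) : ℕ :=
  {b | P.pref b a}.ncard + 1

theorem rank_eq_one_iff [Finite A] (P : Preference A) (a : A) :
    P.rank a = 1 ↔ ∀ b, ¬ P.pref b a := by
  unfold rank
  rw [Nat.add_eq_right, Set.ncard_eq_zero (Set.toFinite _), Set.eq_empty_iff_forall_notMem]
  rfl

theorem exists_rank_eq_one [Finite A] [Nonempty A] (P : Preference A) :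
    ∃ a, P.rank a = 1 := by
  have : Std.Irrefl P.pref := ⟨P.irrefl⟩
  have : IsTrans A P.pref := ⟨P.trans⟩
  have wf : WellFounded P.pref := Finite.wellFounded_of_trans_of_irrefl P.pref
  obtain ⟨a, -, ha⟩ := wf.has_min Set.univ Set.univ_nonempty
  exact ⟨a, (P.rank_eq_one_iff a).2 fun b => ha b trivial⟩

/-- The first-ranked alternative of `P`. -/
noncomputable def top [Finite A] [Nonempty A] (P : Preference A) : A :=
  P.exists_rank_eq_one.choose

theorem top_eq_iff [Finite A] [Nonempty A] (P : Preference A) (a : A) :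
    P.top = a ↔ P.rank a = 1 := by
  have h := P.exists_rank_eq_one.choose_spec
  constructor
  · rintro rfl
    exact h
  · intro ha
    by_contra hne
    rcases P.total _ _ hne with h' | h'
    · exact (P.rank_eq_one_iff a).1 ha _ h'
    · exact (P.rank_eq_one_iff _).1 h _ h'

/-- Two preferences are adjacent if they differ by swapping two consecutively ranked
alternatives. -/
def Adjacent (P P' : Preference A) : Prop :=
  ∃ a b : A, P.rank a = P.rank b + 1 ∧ P'.rank a = P.rank b ∧ P'.rank b = P.rank a ∧
    ∀ c, c ≠ a → c ≠ b → P.rank c = P'.rank c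

/-- The preference given by listing all alternatives from best to worst. -/
def ofList [DecidableEq A] (l : List A) (hl : ∀ a, a ∈ l) : Preference A where
  pref a b := l.idxOf a < l.idxOf b
  irrefl _ := lt_irrefl _
  trans _ _ _ := lt_trans
  total a _ hab := lt_or_gt_of_ne fun h => hab ((List.idxOf_inj (hl a)).1 h)

end Preference

open Preference

section Domains

variable {A : Type*}

/-- A path in the domain `D`: a finite sequence of distinct members of `D`, consecutive ones
being adjacent. -/
def IsPath (D : Set (Preference A)) {t : ℕ} (π : Fin (t + 1) → Preference A) : Prop :=
  (∀ k, π k ∈ D) ∧ Function.Injective π ∧ ∀ k : Fin t, Adjacent (π k.castSucc) (π k.succ)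

/-- A path in `D` from `P` to `P'`. -/
def IsPathFromTo (D : Set (Preference A)) (P P' : Preference A) {t : ℕ}
    (π : Fin (t + 1) → Preference A) : Prop :=
  IsPath D π ∧ π 0 = P ∧ π (Fin.last t) = P'

/-- Every two members of `D` are joined by a path in `D`. -/
def IsConnectedDomain (D : Set (Preference A)) : Prop :=
  ∀ P ∈ D, ∀ P' ∈ D, ∃ (t : ℕ) (π : Fin (t + 1) → Preference A), IsPathFromTo D P P' π

/-- The neighbours in `D` of a sub-domain `E`. -/
def neighbours (E D : Set (Preference A)) : Set (Preference A) :=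
  {P | P ∈ D \ E ∧ ∃ P' ∈ E, Adjacent P' P}

/-- Along `π` the relative ranking of `a` and `b` is reversed at most once. -/
def NoRestoration {t : ℕ} (π : Fin (t + 1) → Preference A) (a b : A) : Prop :=
  ¬ ∃ q r s : Fin (t + 1), q < r ∧ r < s ∧
    (((π q).pref a b ∧ (π r).pref b a ∧ (π s).pref a b) ∨
      ((π q).pref b a ∧ (π r).pref a b ∧ (π s).pref b a))

/-- The pairwise no-restoration property (Property P). -/
def PropertyP (D : Set (Preference A)) : Prop :=
  ∀ P ∈ D, ∀ P' ∈ D, P ≠ P' → ∀ a b : A, a ≠ b →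
    ∃ (t : ℕ) (π : Fin (t + 1) → Preference A), IsPathFromTo D P P' π ∧ NoRestoration π a b

variable [Finite A] [Nonempty A]

/-- Every alternative is first-ranked in some member of `D`. -/
def MinimallyRich (D : Set (Preference A)) : Prop :=
  ∀ a : A, ∃ P ∈ D, P.top = a

/-- `P` and `P'` are joined by a path in `D` along which the top alternative is constant. -/
def TopConnected (D : Set (Preference A)) (P P' : Preference A) : Prop :=
  ∃ (t : ℕ) (π : Fin (t + 1) → Preference A), IsPathFromTo D P P' π ∧ ∀ k, (π k).top = P.top

/-- The top-connected closure of `P` in `D`. -/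
def topConnectedClosure (D : Set (Preference A)) (P : Preference A) : Set (Preference A) :=
  {P' | P' ∈ D ∧ TopConnected D P P'} ∪ {P}

/-- The domain `D` is connected with two distinct neighbours. -/
def ConnectedWithTwoDistinctNeighbours (D : Set (Preference A)) : Prop :=
  IsConnectedDomain D ∧
    ∀ P ∈ D, ∃ P' ∈ neighbours (topConnectedClosure D P) D,
      ∃ P'' ∈ neighbours (topConnectedClosure D P) D, P'.top ≠ P''.top

/-- Sparsely connected domain without restoration: the no-restoration requirement is imposed on
the pairs of alternatives at least one of which is first-ranked somewhere in `D`. -/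
def SparselyConnectedWithoutRestoration (D : Set (Preference A)) : Prop :=
  ∀ P ∈ D, ∀ P' ∈ D, P ≠ P' → ∀ a b : A, a ≠ b → (∃ Q ∈ D, Q.top = a ∨ Q.top = b) →
    ∃ (t : ℕ) (π : Fin (t + 1) → Preference A), IsPathFromTo D P P' π ∧ NoRestoration π a b

end Domains

section SocialChoice

variable {A : Type*} {D : Set (Preference A)} {n : ℕ}

/-- A social choice function for `n` voters on the common domain `D`. -/
abbrev SCF (D : Set (Preference A)) (n : ℕ) := (Fin n → D) → A

/-- If all voters rank `a` first, then `a` is chosen. -/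
def Unanimous (f : SCF D n) : Prop :=
  ∀ (a : A) (P : Fin n → D), (∀ i, (P i).1.rank a = 1) → f P = a

/-- Voter `i` can gain at `P` by reporting some admissible preference adjacent to her own. -/
def LocallyManipulable (f : SCF D n) (i : Fin n) (P : Fin n → D) : Prop :=
  ∃ P' : D, Adjacent (P i).1 P'.1 ∧ (P i).1.pref (f (Function.update P i P')) (f P)

def LocallyStrategyProof (f : SCF D n) : Prop :=
  ∀ (i : Fin n) (P : Fin n → D), ¬ LocallyManipulable f i P

variable [Finite A] [Nonempty A]

def Dictatorial (f : SCF D n) : Prop :=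
  ∃ i : Fin n, ∀ P : Fin n → D, f P = (P i).1.top

def TopsOnly (f : SCF D n) : Prop :=
  ∀ P P' : Fin n → D, (∀ i, (P i).1.top = (P' i).1.top) → f P = f P'

/-- Every unanimous and locally strategy-proof `n`-voter scf on `D` is tops-only. -/
def LTopsOnly (D : Set (Preference A)) (n : ℕ) : Prop :=
  ∀ f : SCF D n, Unanimous f → LocallyStrategyProof f → TopsOnly f

/-- Every unanimous and locally strategy-proof `n`-voter scf on `D` is dictatorial. -/
def LDictatorial (D : Set (Preference A)) (n : ℕ) : Prop :=
  ∀ f : SCF D n, Unanimous f → LocallyStrategyProof f → Dictatorial f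

end SocialChoice

/-- The thirteen rankings, from best to worst; the alternative `a_k` is `k - 1 : Fin 4`. -/
def starTable : Fin 13 → List (Fin 4) :=
  ![[0, 1, 2, 3], [1, 0, 2, 3], [1, 2, 0, 3], [2, 1, 0, 3], [2, 1, 3, 0], [2, 3, 1, 0],
    [3, 2, 1, 0], [3, 2, 0, 1], [3, 0, 2, 1], [3, 0, 1, 2], [0, 3, 1, 2], [0, 1, 3, 2],
    [0, 2, 1, 3]]

theorem mem_starTable : ∀ (j : Fin 13) (a : Fin 4), a ∈ starTable j := by
  decide

/-- The `j`-th preference of the domain. -/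
def starPref (j : Fin 13) : Preference (Fin 4) :=
  ofList (starTable j) (mem_starTable j)

/-- The domain `𝔻*` of thirteen preferences on four alternatives. -/
def starDomain : Set (Preference (Fin 4)) :=
  Set.range starPref

end Voting

namespace Voting

open Preference

/-! The adjacency graph is a 12-cycle with ranking `12` hanging from ranking `0`. If a voter's
ranking changes by moving `b` up past `a`, local strategy-proofness before and after the change
forces the outcome to stay put or to go from `a` to `b`. So two-voter rules are solutions of a
finite constraint system, and propagation shows that the value at the profile `(0, 1)` fixes the
dictator (`two_voter_dictator`).

More voters are handled by induction (`StarRule.exists_dictator`). Identifying two voters leaves a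
rule with one voter fewer, hence with a dictator. If that dictator is the pair, the two-voter result
with the others fixed makes one member a dictator; if every pair is overruled by an outsider, two
such statements clash. Tops-onlyness is a consequence of dictatorship.

The no-restoration conditions fail at the pendant ranking: its only exit undoes a swap that some
destinations require again. -/

/-- The first entry of the `j`-th ranking. -/
def starTop : Fin 13 → Fin 4 :=
  ![0, 1, 1, 2, 2, 2, 3, 3, 3, 3, 0, 0, 0]

/-- The adjacent pairs of rankings: `(i, k, a, b)` says that the `k`-th ranking arises from the
`i`-th one by moving `b` up past `a`. -/
def starSwaps : List (Fin 13 × Fin 13 × Fin 4 × Fin 4) :=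
  let l := [(0, 1, 0, 1), (1, 2, 0, 2), (2, 3, 1, 2), (3, 4, 0, 3), (4, 5, 1, 3), (5, 6, 2, 3),
    (6, 7, 1, 0), (7, 8, 2, 0), (8, 9, 2, 1), (9, 10, 3, 0), (10, 11, 3, 1), (11, 0, 3, 2),
    (0, 12, 1, 2)]
  l ++ l.map fun e => (e.2.1, e.1, e.2.2.2, e.2.2.1)

/-- Adjacency of rankings, on indices. -/
def StarAdj (i k : Fin 13) : Prop :=
  ∃ e ∈ starSwaps, e.1 = i ∧ e.2.1 = k

instance : DecidableRel StarAdj := fun i k => by unfold StarAdj; infer_instance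

/-! ### Constraint propagation for two voters -/

/-- The position of the pair (profile, value) in a bit set. -/
def cellCode (c : Fin 13 × Fin 13) (v : Fin 4) : ℕ :=
  (13 * c.1.val + c.2.val) * 4 + v.val

theorem cellCode_inj {c c' : Fin 13 × Fin 13} {v v' : Fin 4}
    (h : cellCode c v = cellCode c' v') : c = c' ∧ v = v' := by
  obtain ⟨⟨i, hi⟩, ⟨j, hj⟩⟩ := c
  obtain ⟨⟨i', hi'⟩, ⟨j', hj'⟩⟩ := c'
  obtain ⟨v, hv⟩ := v
  obtain ⟨v', hv'⟩ := v'
  simp only [cellCode] at h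
  simp only [Prod.mk.injEq, Fin.mk.injEq]
  omega

/-- Record in the bit set `R` that the value `v` is impossible at the profile `c`. -/
def exclude (R : ℕ) (c : Fin 13 × Fin 13) (v : Fin 4) : ℕ :=
  R ||| 2 ^ cellCode c v

/-- `List.foldl` with a numeral as state, which is evaluated at each step. -/
def evalFold {α : Type*} (g : ℕ → α → ℕ) : List α → ℕ → ℕ
  | [], R => R
  -- Recursion on `g R e` forces it to a literal before the fold continues; both branches then
  -- resume from that same number.
  | e :: l, R => Nat.rec (evalFold g l 0) (fun m _ => evalFold g l (m + 1)) (g R e)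

theorem evalFold_induction {α : Type*} {g : ℕ → α → ℕ} {p : ℕ → Prop} {l : List α} {R : ℕ}
    (hg : ∀ e ∈ l, ∀ R, p R → p (g R e)) (hR : p R) : p (evalFold g l R) := by
  induction l generalizing R with
  | nil => exact hR
  | cons e l ih =>
    have h : p (evalFold g l (g R e)) :=
      ih (fun e' he' => hg e' (List.mem_cons_of_mem _ he')) (hg e List.mem_cons_self R hR)
    rw [evalFold]
    revert h
    cases g R e <;> exact id

/-- No value of `F` is recorded as impossible. -/
def Sound (F : Fin 13 × Fin 13 → Fin 4) (R : ℕ) : Prop :=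
  ∀ c, R.testBit (cellCode c (F c)) = false

theorem Sound.exclude {F : Fin 13 × Fin 13 → Fin 4} {R : ℕ} (hR : Sound F R)
    {c : Fin 13 × Fin 13} {v : Fin 4} (h : F c ≠ v) : Sound F (exclude R c v) := by
  intro c'
  rw [Voting.exclude, Nat.testBit_or, hR c', Nat.testBit_two_pow, Bool.false_or,
    decide_eq_false_iff_not]
  intro he
  obtain ⟨rfl, rfl⟩ := cellCode_inj he
  exact h rfl

/-- Exclude the value `v` at `c` if it is incompatible with what is left at `c'`, where the values
at `c` and `c'` are known to agree unless they are `a` and `b`. -/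
def pruneValue (c c' : Fin 13 × Fin 13) (a b : Fin 4) (R : ℕ) (v : Fin 4) : ℕ :=
  if R.testBit (cellCode c' v) && !(v == a && !R.testBit (cellCode c' b)) then exclude R c v
  else R

theorem Sound.pruneValue {F : Fin 13 × Fin 13 → Fin 4} {R : ℕ} (hR : Sound F R)
    {c c' : Fin 13 × Fin 13} {a b : Fin 4} (h : F c' = F c ∨ F c = a ∧ F c' = b) (v : Fin 4) :
    Sound F (pruneValue c c' a b R v) := by
  unfold Voting.pruneValue
  split_ifs with hv
  · refine hR.exclude ?_
    rintro rfl
    have := hR c'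
    rcases h with h | ⟨rfl, rfl⟩
    · rw [h] at this
      simp [this] at hv
    · simp [this] at hv
  · exact hR

/-- Every comparison of two profiles that differ by an adjacent change of one voter, with every
value. -/
def cellSwaps : List (((Fin 13 × Fin 13) × (Fin 13 × Fin 13) × Fin 4 × Fin 4) × Fin 4) :=
  starSwaps.flatMap fun e => (List.finRange 13).flatMap fun j => (List.finRange 4).flatMap fun v =>
    [(((e.1, j), (e.2.1, j), e.2.2), v), (((j, e.1), (j, e.2.1), e.2.2), v)]

/-- One round of propagation. -/
def sweep (R : ℕ) : ℕ :=
  evalFold (fun R e => pruneValue e.1.1 e.1.2.1 e.1.2.2.1 e.1.2.2.2 R e.2) cellSwaps R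

/-- What is excluded at the start: `F (p, p)` is the top of `p`, and the value at one further
profile lies outside `l`. -/
def startBits (l : List (Fin 4)) : ℕ :=
  evalFold (fun R e => exclude R e.1 e.2)
    ((l.map fun v => ((0, 1), v)) ++ (List.finRange 13).flatMap fun p =>
      ((List.finRange 4).filter (· ≠ starTop p)).map fun v => ((p, p), v)) 0

/-- All values other than the top of one given voter are excluded. -/
def determined (t : Fin 13 × Fin 13 → Fin 13) (R : ℕ) : Bool :=
  (List.finRange 13).all fun i => (List.finRange 13).all fun j => (List.finRange 4).all
    fun v => v == starTop (t (i, j)) || R.testBit (cellCode (i, j) v)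

/-- Several rounds of propagation. -/
def sweeps (n R : ℕ) : ℕ :=
  evalFold (fun R _ => sweep R) (List.replicate n ()) R

/-- Six rounds suffice in either case. Here the value at `(0, 1)` is assumed to be `0`, the top of
the first voter; `determined_snd` assumes only that it is not `0`. -/
theorem determined_fst : determined Prod.fst (sweeps 6 (startBits [1, 2, 3])) = true := by
  decide +kernel

theorem determined_snd : determined Prod.snd (sweeps 6 (startBits [0])) = true := by
  decide +kernel

theorem Sound.sweep {F : Fin 13 × Fin 13 → Fin 4} {R : ℕ}
    (h₁ : ∀ e ∈ starSwaps, ∀ j,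
      F (e.2.1, j) = F (e.1, j) ∨ F (e.1, j) = e.2.2.1 ∧ F (e.2.1, j) = e.2.2.2)
    (h₂ : ∀ e ∈ starSwaps, ∀ j,
      F (j, e.2.1) = F (j, e.1) ∨ F (j, e.1) = e.2.2.1 ∧ F (j, e.2.1) = e.2.2.2)
    (hR : Sound F R) : Sound F (sweep R) := by
  refine evalFold_induction (fun e he R hR => hR.pruneValue ?_ _) hR
  simp only [cellSwaps, List.mem_flatMap, List.mem_cons, List.not_mem_nil, or_false] at he
  obtain ⟨e', he', j, -, v, -, rfl | rfl⟩ := he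
  · exact h₁ e' he' j
  · exact h₂ e' he' j

theorem Sound.startBits {F : Fin 13 × Fin 13 → Fin 4} (hF : ∀ p, F (p, p) = starTop p)
    {l : List (Fin 4)} (hl : F (0, 1) ∉ l) : Sound F (startBits l) := by
  refine evalFold_induction (fun e he R hR => hR.exclude ?_) fun c => Nat.zero_testBit _
  simp only [List.mem_append, List.mem_map, List.mem_flatMap, List.mem_filter,
    decide_eq_true_eq] at he
  rcases he with ⟨v, hv, rfl⟩ | ⟨p, -, v, ⟨-, hv⟩, rfl⟩
  · exact fun h => hl (h ▸ hv)
  · rw [hF]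
    exact hv.symm

theorem Sound.eq_starTop {F : Fin 13 × Fin 13 → Fin 4} {R : ℕ} (hR : Sound F R)
    {t : Fin 13 × Fin 13 → Fin 13} (ht : determined t R = true) (c : Fin 13 × Fin 13) :
    F c = starTop (t c) := by
  simp only [determined, List.all_eq_true, List.mem_finRange, forall_const] at ht
  have := ht c.1 c.2 (F c)
  simpa [hR c] using this

/-- The two-voter case, with unanimity required on the diagonal only. -/
theorem two_voter_dictator {F : Fin 13 × Fin 13 → Fin 4} (hF : ∀ p, F (p, p) = starTop p)
    (h₁ : ∀ e ∈ starSwaps, ∀ j,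
      F (e.2.1, j) = F (e.1, j) ∨ F (e.1, j) = e.2.2.1 ∧ F (e.2.1, j) = e.2.2.2)
    (h₂ : ∀ e ∈ starSwaps, ∀ j,
      F (j, e.2.1) = F (j, e.1) ∨ F (j, e.1) = e.2.2.1 ∧ F (j, e.2.1) = e.2.2.2) :
    (∀ p q, F (p, q) = starTop p) ∨ ∀ p q, F (p, q) = starTop q := by
  have key : ∀ {l : List (Fin 4)} {n : ℕ}, F (0, 1) ∉ l → Sound F (sweeps n (startBits l)) :=
    fun hl => evalFold_induction (fun _ _ _ h => h.sweep h₁ h₂) (.startBits hF hl)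
  by_cases h : F (0, 1) = 0
  · exact .inl fun p q => (key (by simp [h])).eq_starTop determined_fst (p, q)
  · exact .inr fun p q => (key (by simpa using h)).eq_starTop determined_snd (p, q)

/-! ### Arbitrarily many voters -/

section Voters

variable {ι : Type*} [DecidableEq ι]

/-- Unanimity and local strategy-proofness for the domain of thirteen preferences, on indices. -/
structure StarRule (f : (ι → Fin 13) → Fin 4) : Prop where
  unanimous : ∀ s a, (∀ x, starTop (s x) = a) → f s = a
  swap : ∀ s x, ∀ e ∈ starSwaps, s x = e.1 →
    f (Function.update s x e.2.1) = f s ∨ f s = e.2.2.1 ∧ f (Function.update s x e.2.1) = e.2.2.2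

theorem starSwaps_ne : ∀ e ∈ starSwaps, e.2.2.1 ≠ e.2.2.2 := by decide +kernel

theorem starAdj_symm : ∀ i k, StarAdj i k → StarAdj k i := by decide +kernel

theorem starAdj_connected (i k : Fin 13) : Relation.ReflTransGen StarAdj i k := by
  -- A neighbour of smaller index for each nonzero index gives a descent to `0`.
  have hlt : ∀ m, m ≠ 0 → ∃ k < m, StarAdj k m := by decide +kernel
  have h : ∀ m, Relation.ReflTransGen StarAdj 0 m := by
    intro m
    induction m using WellFoundedLT.induction with
    | ind m ih =>
      by_cases hm : m = 0
      · rw [hm]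
      · obtain ⟨k, hk, hkm⟩ := hlt m hm
        exact (ih k hk).tail hkm
  have : Std.Symm StarAdj := ⟨starAdj_symm⟩
  exact (Std.Symm.symm _ _ (h i)).trans (h k)

/-- A property of profiles that is stable under adjacent changes of one voter holds for all
profiles as soon as it holds for one. -/
theorem profile_induction [Finite ι] {T : (ι → Fin 13) → Prop}
    (hT : ∀ s x k, StarAdj (s x) k → T s → T (Function.update s x k)) {s : ι → Fin 13}
    (hs : T s) (s' : ι → Fin 13) : T s' := by
  have hone : ∀ x k s, T s → T (Function.update s x k) := by
    intro x k s hs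
    induction starAdj_connected (s x) k with
    | refl => simpa using hs
    | @tail j k _ hjk ih =>
      simpa using hT _ x k (by simpa using hjk) ih
  have := Fintype.ofFinite ι
  have : ∀ S : Finset ι, T (S.piecewise s' s) := by
    intro S
    induction S using Finset.induction_on with
    | empty => simpa using hs
    | insert x S _ ih =>
      rw [Finset.piecewise_insert]
      exact hone _ _ _ ih
  simpa using this Finset.univ

/-- If a pair of voters dictates whenever its members agree, then one of them is a dictator. -/
theorem StarRule.dictator_of_pair [Finite ι] {f : (ι → Fin 13) → Fin 4} (hf : StarRule f)
    {i j : ι} (hij : i ≠ j) (h : ∀ s, s i = s j → f s = starTop (s i)) :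
    ∃ x, ∀ s, f s = starTop (s x) := by
  let F (s : ι → Fin 13) (c : Fin 13 × Fin 13) : Fin 4 :=
    f (Function.update (Function.update s i c.1) j c.2)
  have hdict : ∀ s, (∀ p q, F s (p, q) = starTop p) ∨ ∀ p q, F s (p, q) = starTop q := by
    intro s
    refine two_voter_dictator (fun p => ?_) (fun e he q => ?_) fun e he p => ?_
    · exact (h _ (by simp [hij])).trans (by simp [hij])
    · have := hf.swap (Function.update (Function.update s i e.1) j q) i e he (by simp [hij])
      rwa [Function.update_comm hij.symm, Function.update_idem] at this
    · have := hf.swap (Function.update (Function.update s i p) j e.1) j e he (by simp)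
      rwa [Function.update_idem] at this
  have hF : ∀ s, F s (s i, s j) = f s := fun s => by simp [F]
  have hstep : ∀ s x k, StarAdj (s x) k → (∀ p q, F s (p, q) = starTop p) →
      ∀ p q, F (Function.update s x k) (p, q) = starTop p := by
    rintro s x k ⟨e, he, hx, rfl⟩ hs
    by_cases hxi : x = i
    · subst hxi
      simpa [F] using hs
    by_cases hxj : x = j
    · subst hxj
      simpa [F, Function.update_comm hij] using hs
    refine (hdict _).resolve_right fun hs' => ?_
    -- If control passed from `i` to `j`, the outcome at `(p, q)` would go from the top of `p` to
    -- that of `q`. The tops differ, and the first is not the `a` from which a move is allowed.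
    obtain ⟨p, q, hpq, hne⟩ : ∃ p q : Fin 13, starTop p ≠ starTop q ∧ starTop p ≠ e.2.2.1 := by
      have : ∀ a : Fin 4, ∃ p q : Fin 13, starTop p ≠ starTop q ∧ starTop p ≠ a := by decide
      exact this _
    have := hf.swap (Function.update (Function.update s i p) j q) x e he (by simp [hxi, hxj, hx])
    rw [Function.update_comm (Ne.symm hxj), Function.update_comm (Ne.symm hxi)] at this
    have e₁ := hs p q
    have e₂ := hs' p q
    simp only [F] at e₁ e₂
    rw [e₁, e₂] at this
    rcases this with h | h
    · exact hpq h.symm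
    · exact hne h.1
  rcases hdict fun _ => 0 with h₀ | h₀
  · exact ⟨i, fun s => by rw [← hF s, profile_induction hstep h₀ s]⟩
  · refine ⟨j, fun s => ?_⟩
    rw [← hF s]
    -- Control by `i` for some choice of the other voters would spread to the constant profile `0`,
    -- where `j` is in control.
    refine (hdict s).resolve_left (fun hs => ?_) _ _
    have := (profile_induction hstep hs (fun _ => 0) 0 1).symm.trans (h₀ 0 1)
    exact absurd this (by decide)

/-- Voter `i` is identified with voter `j`. -/
def mergeVoter (i j : ι) (hij : j ≠ i) (s : {x // x ≠ i} → Fin 13) (x : ι) : Fin 13 :=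
  if h : x = i then s ⟨j, hij⟩ else s ⟨x, h⟩

/-- A change of the merged voter is two successive changes of the same kind. Since `a ≠ b`, the
outcome can go from `a` to `b` in at most one of them. -/
theorem StarRule.merge {f : (ι → Fin 13) → Fin 4} (hf : StarRule f) {i j : ι} (hij : j ≠ i) :
    StarRule fun s => f (mergeVoter i j hij s) := by
  constructor
  · intro s a hs
    refine hf.unanimous _ _ fun x => ?_
    unfold mergeVoter
    split_ifs <;> exact hs _
  · rintro s ⟨x, hx⟩ e he hsx
    by_cases hxj : x = j
    · subst hxj
      set s₀ := mergeVoter i x hx s with hs₀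
      have e₀ : s₀ x = e.1 := by simp [hs₀, mergeVoter, hx, hsx]
      have e₁ : s₀ i = e.1 := by simp [hs₀, mergeVoter, hsx]
      have e₂ : mergeVoter i x hx (Function.update s ⟨x, hx⟩ e.2.1) =
          Function.update (Function.update s₀ x e.2.1) i e.2.1 := by
        ext1 y
        by_cases hy : y = i
        · simp [mergeVoter, hy]
        · by_cases hyx : y = x <;> simp [hs₀, mergeVoter, hy, hyx, hx]
      have h₁ := hf.swap s₀ x e he e₀
      have h₂ := hf.swap (Function.update s₀ x e.2.1) i e he
        (by rw [Function.update_of_ne hx.symm, e₁])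
      have := starSwaps_ne e he
      simp only [e₂]
      grind
    · have e₀ : mergeVoter i j hij (Function.update s ⟨x, hx⟩ e.2.1) =
          Function.update (mergeVoter i j hij s) x e.2.1 := by
        ext1 y
        by_cases hy : y = i
        · subst hy
          simp [mergeVoter, Ne.symm hx, Ne.symm hxj]
        · simp [mergeVoter, hy, Function.update_apply]
      simp only [e₀]
      exact hf.swap _ x e he (by simp [mergeVoter, hx, hsx])

theorem StarRule.exists_dictator (n : ℕ) : ∀ {ι : Type} [DecidableEq ι] [Fintype ι]
    {f : (ι → Fin 13) → Fin 4}, Fintype.card ι = n + 1 → StarRule f →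
    ∃ x, ∀ s, f s = starTop (s x) := by
  induction n with
  | zero =>
    intro ι _ _ f hι hf
    obtain ⟨x, hx⟩ := Fintype.card_eq_one_iff.1 hι
    exact ⟨x, fun s => hf.unanimous _ _ fun y => by rw [hx y]⟩
  | succ n ih =>
    intro ι _ _ f hι hf
    have hmerge : ∀ i j, i ≠ j → ∃ k, ∀ s, s i = s j → f s = starTop (s k) := by
      intro i j hij
      obtain ⟨k, hk⟩ := ih (ι := {x // x ≠ i}) (by simp [hι]) (hf.merge hij.symm)
      refine ⟨k, fun s hs => ?_⟩
      -- As `s i = s j`, restricting `s` and merging again gives back `s`.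
      have := hk fun x => s x
      rw [← this]
      congr 1
      ext1 x
      by_cases hx : x = i <;> simp [mergeVoter, hx, hs]
    by_contra hno
    have houtside : ∀ i j, i ≠ j → ∃ k, k ≠ i ∧ k ≠ j ∧ ∀ s, s i = s j → f s = starTop (s k) := by
      intro i j hij
      obtain ⟨k, hk⟩ := hmerge i j hij
      refine ⟨k, ?_, ?_, hk⟩ <;> rintro rfl
      · exact hno (hf.dictator_of_pair hij hk)
      · exact hno (hf.dictator_of_pair hij fun s hs => by rw [hk s hs, hs])
    obtain ⟨a, b, hab⟩ := Fintype.exists_pair_of_one_lt_card (α := ι) (by omega)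
    obtain ⟨c, hca, hcb, hc⟩ := houtside a b hab
    by_cases h : ∃ l, l ≠ a ∧ l ≠ b ∧ l ≠ c
    · obtain ⟨l, hla, hlb, hlc⟩ := h
      obtain ⟨m, hmc, hml, hm⟩ := houtside c l hlc.symm
      -- Four voters: `a`, `b` agree, so `c` imposes `0`; `c`, `l` agree, so `m`, outside that pair,
      -- imposes `1`.
      let s : ι → Fin 13 := fun x => if x = c ∨ x = l then 0 else 1
      have e₁ := hc s (by simp [s, hca.symm, hcb.symm, hla.symm, hlb.symm])
      have e₂ := hm s (by simp [s])
      rw [e₁] at e₂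
      simp [s, hmc, hml, starTop] at e₂
    · push Not at h
      obtain ⟨d, hda, hdc, hd⟩ := houtside a c hca.symm
      obtain rfl : d = b := by
        by_contra hdb
        exact hdc (h d hda hdb)
      -- Three voters: `c` imposes `1` at `s`. Once voter `a` joins `c`, the remaining voter imposes
      -- `0`, though that change moved `1` up past `0`.
      let s : ι → Fin 13 := fun x => if x = c then 1 else 0
      have e₁ := hc s (by simp [s, hca.symm, hcb.symm])
      have e₂ := hd (Function.update s a 1) (by simp [s, hca])
      have e₃ := hf.swap s a (0, 1, 0, 1) (by decide) (by simp [s, hca.symm])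
      simp only at e₃
      rw [e₁, e₂] at e₃
      simp [s, hcb.symm, hab.symm, starTop] at e₃

end Voters

/-! ### The preferences and their indices -/

/-- Makes ranks computable, so that tops and adjacency become decidable statements about the table.
-/
theorem starPref_rank (j : Fin 13) (a : Fin 4) :
    (starPref j).rank a = (starTable j).idxOf a + 1 := by
  have h : {b | (starPref j).pref b a} =
      ↑(Finset.univ.filter fun b => (starTable j).idxOf b < (starTable j).idxOf a) := by
    ext b
    simp [starPref, ofList]
  rw [rank, h, Set.ncard_coe_finset]
  clear h
  revert j a
  decide

theorem starPref_pref (j : Fin 13) (a b : Fin 4) :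
    (starPref j).pref a b ↔ (starTable j).idxOf a < (starTable j).idxOf b := Iff.rfl

instance (j : Fin 13) (a b : Fin 4) : Decidable ((starPref j).pref a b) :=
  decidable_of_iff _ (starPref_pref j a b).symm

theorem starPref_top (j : Fin 13) : (starPref j).top = starTop j := by
  rw [top_eq_iff, starPref_rank]
  revert j
  decide

theorem adjacent_starPref (i k : Fin 13) : Adjacent (starPref i) (starPref k) ↔ StarAdj i k := by
  simp only [Adjacent, starPref_rank]
  revert i k
  decide +kernel

theorem starPref_injective : Function.Injective starPref := by
  intro i k h
  have h' : ∀ a, (starTable i).idxOf a = (starTable k).idxOf a := fun a => by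
    have := congrArg (fun P => P.rank a) h
    simpa [starPref_rank] using this
  clear h
  revert i k
  decide +kernel

/-- Only the swapped pair changes its order, so every other move of the outcome is a gain for the
change or for its reversal. -/
theorem starSwaps_pref : ∀ e ∈ starSwaps, ∀ v w, v = w ∨ v = e.2.2.1 ∧ w = e.2.2.2 ∨
    (starPref e.1).pref w v ∨ (starPref e.2.1).pref v w := by
  decide +kernel

/-! ### Transfer to social choice functions -/

/-- The `j`-th preference as a member of the domain. -/
def starMem (j : Fin 13) : starDomain := ⟨starPref j, j, rfl⟩

theorem starMem_surjective : Function.Surjective starMem := by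
  rintro ⟨_, j, rfl⟩
  exact ⟨j, rfl⟩

theorem starRule_of_scf {n : ℕ} {f : SCF starDomain n} (hu : Unanimous f)
    (hs : LocallyStrategyProof f) : StarRule fun s : Fin n → Fin 13 => f (starMem ∘ s) := by
  constructor
  · intro s a h
    refine hu a _ fun x => ?_
    rw [← top_eq_iff]
    exact (starPref_top _).trans (h x)
  · intro s x e he hx
    have hadj : StarAdj (s x) e.2.1 := ⟨e, he, hx.symm, rfl⟩
    have hadj' : StarAdj e.2.1 (s x) := starAdj_symm _ _ hadj
    have hup : starMem ∘ Function.update s x e.2.1 =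
        Function.update (starMem ∘ s) x (starMem e.2.1) := Function.comp_update ..
    have h₁ : ¬ (starPref e.1).pref (f (starMem ∘ Function.update s x e.2.1)) (f (starMem ∘ s)) := by
      intro h
      refine hs x (starMem ∘ s) ⟨starMem e.2.1, (adjacent_starPref _ _).2 hadj, ?_⟩
      rw [← hup]
      simpa [starMem, hx] using h
    have h₂ : ¬ (starPref e.2.1).pref (f (starMem ∘ s))
        (f (starMem ∘ Function.update s x e.2.1)) := by
      intro h
      refine hs x (starMem ∘ Function.update s x e.2.1) ⟨starMem (s x), ?_, ?_⟩
      · simpa [starMem] using (adjacent_starPref _ _).2 hadj'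
      · rw [hup, Function.update_idem,
          show starMem (s x) = (starMem ∘ s) x from rfl, Function.update_eq_self, ← hup]
        simpa [starMem] using h
    rcases starSwaps_pref e he (f (starMem ∘ s)) (f (starMem ∘ Function.update s x e.2.1)) with
      h | h | h | h
    · exact .inl h.symm
    · exact .inr h
    · exact absurd h h₁
    · exact absurd h h₂

theorem starDomain_lDictatorial {n : ℕ} (hn : 1 ≤ n) : LDictatorial starDomain n := by
  intro f hu hs
  obtain ⟨x, hx⟩ := StarRule.exists_dictator (n - 1) (by simp; omega) (starRule_of_scf hu hs)
  refine ⟨x, fun P => ?_⟩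
  choose s hs using fun y => starMem_surjective (P y)
  obtain rfl : starMem ∘ s = P := funext hs
  rw [hx s]
  exact (starPref_top _).symm

theorem LDictatorial.lTopsOnly {A : Type*} [Finite A] [Nonempty A] {D : Set (Preference A)} {n : ℕ}
    (h : LDictatorial D n) : LTopsOnly D n := by
  intro f hu hs P P' hP
  obtain ⟨i, hi⟩ := h f hu hs
  rw [hi, hi, hP i]

theorem starDomain_ncard : starDomain.ncard = 13 := by
  rw [starDomain, ← Set.image_univ, Set.ncard_image_of_injective _ starPref_injective]
  simp

theorem starDomain_minimallyRich : MinimallyRich starDomain := by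
  intro a
  have : ∀ a, ∃ j, starTop j = a := by decide
  obtain ⟨j, rfl⟩ := this a
  exact ⟨starPref j, ⟨j, rfl⟩, starPref_top j⟩

/-! ### Paths -/

theorem isPathFromTo_starPref {i k : Fin 13} {l : List (Fin 13)} (hn : (i :: l).Nodup)
    (hc : (i :: l).IsChain StarAdj) (hk : (i :: l).getLast (List.cons_ne_nil _ _) = k) :
    IsPathFromTo starDomain (starPref i) (starPref k)
      (t := l.length) fun m => starPref ((i :: l).get m) := by
  refine ⟨⟨fun m => ⟨_, rfl⟩, starPref_injective.comp (List.nodup_iff_injective_get.1 hn),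
    fun m => (adjacent_starPref _ _).2 ?_⟩, rfl, ?_⟩
  · exact List.isChain_iff_getElem.1 hc m (by simp)
  · rw [← hk, List.getLast_eq_getElem]
    rfl

theorem starDomain_isConnectedDomain : IsConnectedDomain starDomain := by
  -- Around the cycle of the first twelve preferences, entering and leaving the last one by `0`.
  let arc (i k : Fin 13) : List (Fin 13) :=
    (List.range ((k.val + 12 - i.val) % 12 + 1)).map fun m => Fin.ofNat 13 ((i.val + m) % 12)
  let tail (i k : Fin 13) : List (Fin 13) :=
    if i = 12 then if k = 12 then [] else arc 0 k
    else if k = 12 then (arc i 0).tail ++ [12] else (arc i k).tail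
  have h : ∀ i k, (i :: tail i k).Nodup ∧ (i :: tail i k).IsChain StarAdj ∧
      (i :: tail i k).getLast (List.cons_ne_nil _ _) = k := by
    decide +kernel
  rintro _ ⟨i, rfl⟩ _ ⟨k, rfl⟩
  exact ⟨_, _, isPathFromTo_starPref (h i k).1 (h i k).2.1 (h i k).2.2⟩

/-- The list is a path with constant top from `i` to `m`; the differing top keeps `k` out of the
closure. -/
theorem mem_neighbours_topConnectedClosure {i m k : Fin 13} {l : List (Fin 13)}
    (hn : (i :: l).Nodup) (hc : (i :: l).IsChain StarAdj)
    (hm : (i :: l).getLast (List.cons_ne_nil _ _) = m) (ht : ∀ j ∈ i :: l, starTop j = starTop i)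
    (hk : starTop k ≠ starTop i) (hmk : StarAdj m k) :
    starPref k ∈ neighbours (topConnectedClosure starDomain (starPref i)) starDomain := by
  refine ⟨⟨⟨k, rfl⟩, ?_⟩, starPref m, .inl ⟨⟨m, rfl⟩, _, _, isPathFromTo_starPref hn hc hm, ?_⟩,
    (adjacent_starPref _ _).2 hmk⟩
  · rintro (⟨-, t, π, ⟨-, -, hπ⟩, h⟩ | h)
    · have := h (Fin.last t)
      rw [hπ, starPref_top, starPref_top] at this
      exact hk this
    · exact hk (congrArg starTop (starPref_injective h))
  · intro j
    rw [starPref_top, starPref_top]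
    exact ht _ (List.get_mem _ _)

theorem starDomain_connectedWithTwoDistinctNeighbours :
    ConnectedWithTwoDistinctNeighbours starDomain := by
  refine ⟨starDomain_isConnectedDomain, ?_⟩
  rintro _ ⟨i, rfl⟩
  -- `up` and `down` run in the two directions of the cycle to the ends of the block with the same
  -- top; ranking `12` enters by `0`.
  let up : Fin 13 → List (Fin 13) :=
    ![[], [2], [], [4, 5], [5], [], [7, 8, 9], [8, 9], [9], [], [11, 0], [0], [0]]
  let down : Fin 13 → List (Fin 13) :=
    ![[11, 10], [], [1], [], [3], [4, 3], [], [6], [7, 6], [8, 7, 6], [], [10], [0, 11, 10]]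
  have h : ∀ i, ∀ l ∈ [up i, down i], (i :: l).Nodup ∧ (i :: l).IsChain StarAdj ∧
      ∀ j ∈ i :: l, starTop j = starTop i := by
    decide +kernel
  have h' : ∀ i, ∃ k k', starTop k ≠ starTop k' ∧ starTop k ≠ starTop i ∧ starTop k' ≠ starTop i ∧
      StarAdj ((i :: up i).getLast (List.cons_ne_nil _ _)) k ∧
      StarAdj ((i :: down i).getLast (List.cons_ne_nil _ _)) k' := by
    decide +kernel
  obtain ⟨k, k', hkk', hk, hk', ha, ha'⟩ := h' i
  obtain ⟨u₁, u₂, u₃⟩ := h i (up i) (by simp)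
  obtain ⟨d₁, d₂, d₃⟩ := h i (down i) (by simp)
  exact ⟨_, mem_neighbours_topConnectedClosure u₁ u₂ rfl u₃ hk ha,
    _, mem_neighbours_topConnectedClosure d₁ d₂ rfl d₃ hk' ha', by rwa [starPref_top, starPref_top]⟩

/-! ### Failure of the no-restoration conditions -/

/-- Every path from `0213` to `2310` passes through `0123`, so that the alternatives `1` and `2`
change places twice. -/
theorem starDomain_restoration {t : ℕ} {π : Fin (t + 1) → Preference (Fin 4)}
    (hπ : IsPathFromTo starDomain (starPref 12) (starPref 5) π) : ¬ NoRestoration π 1 2 := by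
  obtain ⟨⟨hD, -, hadj⟩, hzero, hlast⟩ := hπ
  rcases t with _ | t
  · have : starPref 12 = starPref 5 := hzero.symm.trans hlast
    exact absurd (starPref_injective this) (by decide)
  obtain ⟨k, hk⟩ := hD 1
  have hone : π 1 = starPref 0 := by
    have h := hadj 0
    rw [show Fin.castSucc (0 : Fin (t + 1)) = 0 from rfl, hzero,
      show Fin.succ (0 : Fin (t + 1)) = 1 from rfl, ← hk, adjacent_starPref] at h
    have : ∀ k, StarAdj 12 k → k = 0 := by decide
    rw [← hk, this k h]
  -- A path with one edge would end at ranking `0`, so the last index lies strictly beyond `1`.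
  rcases t with _ | t
  · have : starPref 0 = starPref 5 := hone.symm.trans hlast
    exact absurd (starPref_injective this) (by decide)
  refine fun h => h ⟨0, 1, Fin.last _, ?_, ?_, .inr ?_⟩
  · simp
  · simp [Fin.lt_def]
  · rw [hzero, hone, hlast]
    decide

theorem starDomain_not_sparselyConnectedWithoutRestoration :
    ¬ SparselyConnectedWithoutRestoration starDomain := by
  intro h
  obtain ⟨t, π, hπ, hr⟩ := h (starPref 12) ⟨12, rfl⟩ (starPref 5) ⟨5, rfl⟩
    (starPref_injective.ne (by decide)) 1 2 (by decide)
    ⟨starPref 1, ⟨1, rfl⟩, .inl (starPref_top 1)⟩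
  exact starDomain_restoration hπ hr

theorem PropertyP.sparselyConnectedWithoutRestoration {A : Type*} [Finite A] [Nonempty A]
    {D : Set (Preference A)} (h : PropertyP D) : SparselyConnectedWithoutRestoration D :=
  fun P hP P' hP' hne a b hab _ => h P hP P' hP' hne a b hab

end Voting

theorem mainTheorem5 :
    Voting.starDomain.ncard = 13 ∧
    Voting.MinimallyRich Voting.starDomain ∧
    (∀ n : ℕ, 2 ≤ n → Voting.LTopsOnly Voting.starDomain n) ∧
    (∀ n : ℕ, 2 ≤ n → Voting.LDictatorial Voting.starDomain n) ∧
    Voting.ConnectedWithTwoDistinctNeighbours Voting.starDomain ∧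
    ¬ Voting.PropertyP Voting.starDomain ∧
    ¬ Voting.SparselyConnectedWithoutRestoration Voting.starDomain :=
  ⟨Voting.starDomain_ncard, Voting.starDomain_minimallyRich,
    fun _ hn => (Voting.starDomain_lDictatorial (by omega)).lTopsOnly,
    fun _ hn => Voting.starDomain_lDictatorial (by omega),
    Voting.starDomain_connectedWithTwoDistinctNeighbours,
    fun h => Voting.starDomain_not_sparselyConnectedWithoutRestoration
      h.sparselyConnectedWithoutRestoration,
    Voting.starDomain_not_sparselyConnectedWithoutRestoration⟩
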